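/- Let $r\ge 1$, let $\alpha_1,\dots,\alpha_r,\beta>-1$ be real with $\alpha_i-\alpha_j\notin\mathbb{Z}$ for $i\neq j$. For $\vec n=(n_1,\dots,n_r)\in\mathbb{N}^r$ (where $0\in\mathbb N$) put $|\vec n|=n_1+\cdots+n_r$, and let $\vec e_j$ be the $j$-th unit vector. There is exactly one monic polynomial $P_{\vec n}$ of degree $|\vec n|$ (the Jacobi–Piñeiro polynomial) with $$\int_0^1 P_{\vec n}(x)\,x^k\,x^{\alpha_j}(1-x)^\beta\,dx=0,\qquad 0\le k\le n_j-1,\ 1\le j\le r,$$ and there are unique real numbers $a_{\vec n,j},b_{\vec n,k}$, with $a_{\vec n,j}=0$ if $n_j=0$, such that $$xP_{\vec n}(x)=P_{\vec n+\vec e_k}(x)+b_{\vec n,k}P_{\vec n}(x)+\sum_{j:\,n_j\ge1}a_{\vec n,j}P_{\vec n-\vec e_j}(x),\qquad k=1,\dots,r.$$ Let $q_r(z)=\prod_{j=1}^r(z-\alpha_j)$, $Q_{r,\vec n}(z)=\prod_{j=1}^r(z-n_j-\alpha_j)$, and let $\delta_{\vec n}$ be the coefficient of $x^{|\vec n|-1}$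 in $P_{\vec n}$ (with $\delta_{\vec 0}=0$). Then, for all $\vec n$ and all $1\le j,k\le r$: 1. $$a_{\vec n,j}=\prod_{i\ne j}\frac{n_j+\alpha_j-\alpha_i}{n_j-n_i+\alpha_j-\alpha_i}\ \prod_{i=1}^r\frac{|\vec n|+\alpha_i+\beta}{|\vec n|+n_i+\alpha_i+\beta}\ \cdot\frac{n_j(n_j+\alpha_j)(|\vec n|+\beta)}{(|\vec n|+n_j+\alpha_j+\beta+1)(|\vec n|+n_j+\alpha_j+\beta)(|\vec n|+n_j+\alpha_j+\beta-1)}.$$ 2. $$\delta_{\vec n}=-(|\vec n|+\beta)\,\frac{q_r(-|\vec n|-\beta)}{Q_{r,\vec n}(-|\vec n|-\beta)}+\beta .$$ 3. $b_{\vec n,k}=\delta_{\vec n}-\delta_{\vec n+\vec e_k}$. 4. With $f(z)=z\,q_r(z)/Q_{r,\vec n}(z)$ and $z_0=-|\vec n|-\beta$, $$\sum_{j=1}^r a_{\vec n,j}=(|\vec n|+\beta)\,\frac{q_r(z_0)}{Q_{r,\vec n}(z_0)}\cdot\left(-\tfrac12\right)\bigl(f(z_0+1)-2f(z_0)+f(z_0-1)\bigr).$$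 The formulas in 1, 2 and 4 hold as written whenever the denominators occurring in them are nonzero. For the exceptional parameters at which a denominator vanishes (this can happen only for $|\vec n|\le2$), the right-hand side is understood as its limit as $\beta'\to\beta$, $\beta'\ne\beta$, where $\beta$ is replaced by $\beta'$ in the formula. -/

import Mathlib

/-!
For a polynomial `p` of degree at most `N`, the moment `∫₀¹ p(x) x^s (1 - x)^β dx` equals
`Γ(s + 1) Γ(β + 1) / Γ(s + β + N + 2)` times a polynomial in `s` of degree at most `N`, and this
transform of `p` is injective. Orthogonality of `P_n` says that the transform vanishes at the `|n|`
nodes `α_j + k`, `k < n_j`, which are distinct because `α_i - α_j ∉ ℤ`; hence it is a multiple of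
the nodal polynomial, and this gives existence and uniqueness of `P_n` and all its moments.

The values of the transform at `s = -|n| - β - 1` and `s = -|n| - β` read off the two leading
coefficients of `P_n`, hence `δ_n`. Testing the recurrence against `x^(α_j + n_j - 1)` shows that
`a_{n,j}` is the quotient of the moment of `P_n` at `s = α_j + n_j` and that of `P_{n - e_j}` at
`s = α_j + n_j - 1`. Finally, the sum of the `a_{n,j}` is part of the divided difference of
`z q_r(z)` at the `r + 3` nodes `n_j + α_j`, `z₀ + 1`, `z₀`, `z₀ - 1`, which vanishes.

In terms of the nodal polynomial the expressions for `δ_n` and `a_{n,j}` have no vanishing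
denominators, so they are continuous in `β`; this gives the limits at the exceptional parameters.
-/

open Polynomial Filter Topology

noncomputable section

namespace JacobiPineiro

/-- The size `|n| = n₁ + ⋯ + n_r` of a multi-index. -/
def size {r : ℕ} (n : Fin r → ℕ) : ℕ := ∑ i, n i

/-- `p` is a type II multiple orthogonal polynomial of multi-index `n` for the weights
`x ^ (α j) * (1 - x) ^ β` on `[0, 1]`: it is monic of degree `|n|`, and orthogonal to
`x ^ k`, `k < n j`, with respect to the `j`-th weight. -/
structure IsTypeII {r : ℕ} (α : Fin r → ℝ) (β : ℝ) (n : Fin r → ℕ) (p : ℝ[X]) : Prop where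
  monic : p.Monic
  natDegree_eq : p.natDegree = size n
  orthogonal : ∀ j : Fin r, ∀ k : ℕ, k < n j →
    ∫ x in (0 : ℝ)..1, p.eval x * x ^ k * (x ^ (α j) * (1 - x) ^ β) = 0

/-- `a = (a_{n,1}, …, a_{n,r})` and `b = (b_{n,1}, …, b_{n,r})` are nearest-neighbor recurrence
coefficients at `n` of the family `P`: for every `k`,
`x P_n = P_{n + e_k} + b_{n,k} P_n + ∑_j a_{n,j} P_{n - e_j}`.
The terms with `n j = 0`, where `n - e_j` is not a multi-index, are absent, and by convention
`a_{n,j} = 0` for them. -/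
structure IsRecurrenceCoeff {r : ℕ} (P : (Fin r → ℕ) → ℝ[X]) (n : Fin r → ℕ)
    (a b : Fin r → ℝ) : Prop where
  boundary : ∀ j, n j = 0 → a j = 0
  recurrence : ∀ k, X * P n = P (n + Pi.single k 1) + C (b k) * P n
    + ∑ j, if n j = 0 then 0 else C (a j) * P (n - Pi.single j 1)

/-- `q_r(x) = ∏_j (x - α_j)`. -/
def q {r : ℕ} (α : Fin r → ℝ) : ℝ[X] := ∏ j, (X - C (α j))

/-- `Q_{r,n}(x) = ∏_j (x - n_j - α_j)`. -/
def Q {r : ℕ} (α : Fin r → ℝ) (n : Fin r → ℕ) : ℝ[X] := ∏ j, (X - C ((n j : ℝ) + α j))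

/-- The quotient `q_r(z) / Q_{r,n}(z)`. -/
def quot {r : ℕ} (α : Fin r → ℝ) (n : Fin r → ℕ) (z : ℝ) : ℝ := (q α).eval z / (Q α n).eval z

/-- The second difference `(Δ∇f)(z) = f(z + 1) - 2 f(z) + f(z - 1)`. -/
def secondDiff (f : ℝ → ℝ) (z : ℝ) : ℝ := f (z + 1) - 2 * f z + f (z - 1)

/-- The explicit product for `a_{n,j}`. -/
def aFormula {r : ℕ} (α : Fin r → ℝ) (β : ℝ) (n : Fin r → ℕ) (j : Fin r) : ℝ :=
  (∏ i ∈ Finset.univ.erase j, ((n j : ℝ) + α j - α i) / ((n j : ℝ) - n i + α j - α i))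
  * (∏ i, ((size n : ℝ) + α i + β) / ((size n : ℝ) + n i + α i + β))
  * ((n j : ℝ) * (n j + α j) * (size n + β)
    / (((size n : ℝ) + n j + α j + β + 1) * ((size n : ℝ) + n j + α j + β)
      * ((size n : ℝ) + n j + α j + β - 1)))

/-- The explicit expression for `δ_n`. -/
def deltaFormula {r : ℕ} (α : Fin r → ℝ) (β : ℝ) (n : Fin r → ℕ) : ℝ :=
  -((size n : ℝ) + β) * quot α n (-(size n : ℝ) - β) + β

/-- The closed form of `∑_j a_{n,j}`. -/
def sumFormula {r : ℕ} (α : Fin r → ℝ) (β : ℝ) (n : Fin r → ℕ) : ℝ :=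
  ((size n : ℝ) + β) * quot α n (-(size n : ℝ) - β)
  * (-(1 / 2) * secondDiff (fun z => z * quot α n z) (-(size n : ℝ) - β))

end JacobiPineiro

end

noncomputable section

namespace JacobiPineiro

/-! ### Moments of polynomials for the beta weight -/

section BetaIntegral

variable {s b : ℝ}

theorem ofReal_rpow_mul_one_sub_rpow {x : ℝ} (hx : x ∈ Set.Icc 0 1) :
    (x : ℂ) ^ (((s + 1 : ℝ) : ℂ) - 1) * (1 - (x : ℂ)) ^ (((b + 1 : ℝ) : ℂ) - 1) =
      ((x ^ s * (1 - x) ^ b : ℝ) : ℂ) := by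
  have hexp (t : ℝ) : ((t + 1 : ℝ) : ℂ) - 1 = t := by push_cast; ring
  rw [hexp, hexp, Complex.ofReal_mul, Complex.ofReal_cpow hx.1,
    Complex.ofReal_cpow (sub_nonneg.2 hx.2), Complex.ofReal_sub, Complex.ofReal_one]

theorem intervalIntegrable_rpow_mul_one_sub_rpow (hs : -1 < s) (hb : -1 < b) :
    IntervalIntegrable (fun x : ℝ => x ^ s * (1 - x) ^ b) MeasureTheory.volume 0 1 := by
  have hconv := Complex.betaIntegral_convergent (u := ((s + 1 : ℝ) : ℂ)) (v := ((b + 1 : ℝ) : ℂ))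
    (by rw [Complex.ofReal_re]; linarith) (by rw [Complex.ofReal_re]; linarith)
  rw [intervalIntegrable_iff_integrableOn_Ioc_of_le zero_le_one] at hconv ⊢
  refine (MeasureTheory.Integrable.re hconv).congr ?_
  filter_upwards [MeasureTheory.ae_restrict_mem measurableSet_Ioc] with x hx
  rw [ofReal_rpow_mul_one_sub_rpow (Set.Ioc_subset_Icc_self hx)]
  exact Complex.ofReal_re _

theorem integral_rpow_mul_one_sub_rpow (hs : -1 < s) (hb : -1 < b) :
    ∫ x in (0 : ℝ)..1, x ^ s * (1 - x) ^ b = ProbabilityTheory.beta (s + 1) (b + 1) := by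
  have hcomplex : Complex.betaIntegral ((s + 1 : ℝ) : ℂ) ((b + 1 : ℝ) : ℂ) =
      ((∫ x in (0 : ℝ)..1, x ^ s * (1 - x) ^ b : ℝ) : ℂ) := by
    rw [Complex.betaIntegral, ← intervalIntegral.integral_ofReal]
    refine intervalIntegral.integral_congr fun x hx => ?_
    rw [Set.uIcc_of_le zero_le_one] at hx
    exact ofReal_rpow_mul_one_sub_rpow hx
  rw [ProbabilityTheory.beta_eq_betaIntegralReal _ _ (by linarith) (by linarith), hcomplex,
    Complex.ofReal_re]

end BetaIntegral

section Moment

variable {β s : ℝ}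

/-- The moment functional `p ↦ ∫₀¹ p(x) x ^ s (1 - x) ^ β dx`, defined through its values
`B(s + k + 1, β + 1)` on the monomials `x ^ k`, so that linearity holds for all parameters. -/
def betaMoment (β s : ℝ) : ℝ[X] →ₗ[ℝ] ℝ :=
  Polynomial.lsum fun k =>
    LinearMap.toSpanSingleton ℝ ℝ (ProbabilityTheory.beta (s + k + 1) (β + 1))

theorem betaMoment_monomial (β s : ℝ) (k : ℕ) (c : ℝ) :
    betaMoment β s (monomial k c) = c * ProbabilityTheory.beta (s + k + 1) (β + 1) := by
  simp [betaMoment]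

theorem betaMoment_eq_sum_range (β s : ℝ) {N : ℕ} {p : ℝ[X]} (hp : p.natDegree ≤ N) :
    betaMoment β s p =
      ∑ k ∈ Finset.range (N + 1), p.coeff k * ProbabilityTheory.beta (s + k + 1) (β + 1) := by
  conv_lhs => rw [p.as_sum_range' (N + 1) (Nat.lt_succ_of_le hp), map_sum]
  simp only [betaMoment_monomial]

theorem betaMoment_C_mul (β s c : ℝ) (p : ℝ[X]) :
    betaMoment β s (C c * p) = c * betaMoment β s p := by
  rw [← smul_eq_C_mul, map_smul, smul_eq_mul]

theorem betaMoment_X_mul (β s : ℝ) (p : ℝ[X]) :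
    betaMoment β s (X * p) = betaMoment β (s + 1) p := by
  induction p using Polynomial.induction_on' with
  | add p q hp hq => rw [mul_add, map_add, map_add, hp, hq]
  | monomial k c =>
    rw [X_mul_monomial, betaMoment_monomial, betaMoment_monomial, Nat.cast_succ, add_right_comm s 1,
      ← add_assoc]

theorem integral_eval_mul (hs : -1 < s) (hβ : -1 < β) (p : ℝ[X]) :
    ∫ x in (0 : ℝ)..1, p.eval x * (x ^ s * (1 - x) ^ β) = betaMoment β s p := by
  have hint (p : ℝ[X]) : IntervalIntegrable (fun x : ℝ => p.eval x * (x ^ s * (1 - x) ^ β))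
      MeasureTheory.volume 0 1 :=
    (intervalIntegrable_rpow_mul_one_sub_rpow hs hβ).continuousOn_mul p.continuous.continuousOn
  induction p using Polynomial.induction_on' with
  | add p q hp hq =>
    simp only [eval_add, add_mul, map_add, ← hp, ← hq]
    exact intervalIntegral.integral_add (hint p) (hint q)
  | monomial k c =>
    have hsk : -1 < s + k := by linarith [k.cast_nonneg (α := ℝ)]
    rw [betaMoment_monomial, ← integral_rpow_mul_one_sub_rpow hsk hβ,
      ← intervalIntegral.integral_const_mul]
    refine intervalIntegral.integral_congr_ae (.of_forall fun x hx => ?_)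
    rw [Set.uIoc_of_le zero_le_one] at hx
    rw [eval_monomial, Real.rpow_add_natCast hx.1.ne']
    ring

theorem integral_eval_mul_pow_mul (hs : -1 < s) (hβ : -1 < β) (k : ℕ) (p : ℝ[X]) :
    ∫ x in (0 : ℝ)..1, p.eval x * x ^ k * (x ^ s * (1 - x) ^ β) = betaMoment β (s + k) p := by
  rw [← integral_eval_mul (by linarith [k.cast_nonneg (α := ℝ)]) hβ]
  refine intervalIntegral.integral_congr_ae (.of_forall fun x hx => ?_)
  rw [Set.uIoc_of_le zero_le_one] at hx
  rw [Real.rpow_add_natCast hx.1.ne']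
  ring

end Moment

section MomentTransform

theorem Gamma_add_natCast {x : ℝ} (hx : 0 < x) (n : ℕ) :
    Real.Gamma (x + n) = (ascPochhammer ℝ n).eval x * Real.Gamma x := by
  induction n with
  | zero => simp
  | succ n ih =>
    rw [Nat.cast_succ, ← add_assoc, Real.Gamma_add_one (by positivity), ih,
      ascPochhammer_succ_eval]
    ring

/-- The common factor `Γ(s + 1) Γ(β + 1) / Γ(s + β + N + 2)` of the moments of all polynomials of
degree at most `N`. -/
def gammaFactor (β : ℝ) (N : ℕ) (s : ℝ) : ℝ :=
  Real.Gamma (s + 1) * Real.Gamma (β + 1) / Real.Gamma (s + β + N + 2)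

/-- The polynomial in `s` that is left of `s ↦ ∫₀¹ p(x) x ^ s (1 - x) ^ β dx` after division by
`gammaFactor β N s`, for `p` of degree at most `N`. -/
def momentTransform (β : ℝ) (N : ℕ) (p : ℝ[X]) : ℝ[X] :=
  ∑ k ∈ Finset.range (N + 1), C (p.coeff k) *
    ((ascPochhammer ℝ k).comp (X + C 1) * (ascPochhammer ℝ (N - k)).comp (X + C (β + k + 2)))

variable {β s : ℝ} {N : ℕ}

theorem eval_momentTransform (β : ℝ) (N : ℕ) (p : ℝ[X]) (s : ℝ) :
    (momentTransform β N p).eval s = ∑ k ∈ Finset.range (N + 1), p.coeff k *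
      ((ascPochhammer ℝ k).eval (s + 1) * (ascPochhammer ℝ (N - k)).eval (s + (β + k + 2))) := by
  simp [momentTransform, eval_finsetSum]

theorem natDegree_momentTransform_le (β : ℝ) (N : ℕ) (p : ℝ[X]) :
    (momentTransform β N p).natDegree ≤ N := by
  refine natDegree_sum_le_of_forall_le _ _ fun k hk => ?_
  refine (natDegree_C_mul_le _ _).trans (natDegree_mul_le.trans ?_)
  rw [natDegree_comp, natDegree_comp, natDegree_X_add_C, natDegree_X_add_C,
    ascPochhammer_natDegree, ascPochhammer_natDegree]
  have := Finset.mem_range.1 hk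
  lia

theorem gammaFactor_pos (hs : -1 < s) (hβ : -1 < β) (N : ℕ) : 0 < gammaFactor β N s :=
  div_pos
    (mul_pos (Real.Gamma_pos_of_pos (by linarith)) (Real.Gamma_pos_of_pos (by linarith)))
    (Real.Gamma_pos_of_pos (by linarith [N.cast_nonneg (α := ℝ)]))

theorem gammaFactor_succ (hs : -1 < s) (hβ : -1 < β) (N : ℕ) :
    gammaFactor β (N + 1) (s + 1) =
      gammaFactor β N s * ((s + 1) / ((s + β + N + 2) * (s + β + N + 3))) := by
  have hpos : 0 < s + β + N + 2 := by linarith [N.cast_nonneg (α := ℝ)]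
  have hnum : Real.Gamma (s + 1 + 1) = (s + 1) * Real.Gamma (s + 1) :=
    Real.Gamma_add_one (by linarith)
  have hden := Gamma_add_natCast hpos 2
  have hasc : (ascPochhammer ℝ 2).eval (s + β + N + 2) = (s + β + N + 2) * (s + β + N + 3) := by
    simp only [ascPochhammer_succ_eval, ascPochhammer_zero, eval_one, Nat.cast_zero, Nat.cast_one]
    ring
  have hΓ := (Real.Gamma_pos_of_pos hpos).ne'
  rw [gammaFactor, gammaFactor, hnum,
    show s + 1 + β + (N + 1 : ℕ) + 2 = s + β + N + 2 + (2 : ℕ) by push_cast; ring, hden, hasc]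
  field_simp

theorem beta_eq_gammaFactor_mul (hs : -1 < s) (hβ : -1 < β) {k : ℕ} (hk : k ≤ N) :
    ProbabilityTheory.beta (s + k + 1) (β + 1) = gammaFactor β N s *
      ((ascPochhammer ℝ k).eval (s + 1) * (ascPochhammer ℝ (N - k)).eval (s + (β + k + 2))) := by
  obtain ⟨m, rfl⟩ := Nat.exists_eq_add_of_le hk
  have hpos : 0 < s + (β + k + 2) := by linarith [k.cast_nonneg (α := ℝ)]
  have hnum := Gamma_add_natCast (x := s + 1) (by linarith) k
  have hden := Gamma_add_natCast hpos m
  have hΓ := (Real.Gamma_pos_of_pos hpos).ne'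
  have hasc := (ascPochhammer_pos m _ hpos).ne'
  rw [ProbabilityTheory.beta, gammaFactor, Nat.add_sub_cancel_left, add_right_comm s, hnum,
    show s + 1 + k + (β + 1) = s + (β + k + 2) by ring,
    show s + β + (k + m : ℕ) + 2 = s + (β + k + 2) + m by push_cast; ring, hden]
  field_simp

theorem betaMoment_eq_gammaFactor_mul (hs : -1 < s) (hβ : -1 < β) {p : ℝ[X]}
    (hp : p.natDegree ≤ N) :
    betaMoment β s p = gammaFactor β N s * (momentTransform β N p).eval s := by
  rw [betaMoment_eq_sum_range β s hp, eval_momentTransform, Finset.mul_sum]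
  refine Finset.sum_congr rfl fun k hk => ?_
  rw [beta_eq_gammaFactor_mul hs hβ (Finset.mem_range_succ_iff.1 hk)]
  ring

/-- The summands with `k < N` contain a vanishing Pochhammer factor. -/
theorem eval_momentTransform_neg_sub_one (β : ℝ) (N : ℕ) (p : ℝ[X]) :
    (momentTransform β N p).eval (-N - β - 1) =
      p.coeff N * (ascPochhammer ℝ N).eval (-β - N) := by
  rw [eval_momentTransform, Finset.sum_range_succ, Finset.sum_eq_zero, zero_add]
  · rw [Nat.sub_self, ascPochhammer_zero, eval_one, mul_one]
    ring_nf
  · intro k hk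
    obtain ⟨m, rfl⟩ := Nat.exists_eq_add_of_lt (Finset.mem_range.1 hk)
    rw [show -((k + m + 1 : ℕ) : ℝ) - β - 1 + (β + k + 2) = -(m : ℝ) by push_cast; ring,
      ascPochhammer_eval_neg_coe_nat_of_lt (by lia), mul_zero, mul_zero]

/-- The summands with `k < M` contain a vanishing Pochhammer factor. -/
theorem eval_momentTransform_neg (β : ℝ) (M : ℕ) (p : ℝ[X]) :
    (momentTransform β (M + 1) p).eval (-(M + 1 : ℕ) - β) =
      (p.coeff M - β * p.coeff (M + 1)) * (ascPochhammer ℝ M).eval (-β - M) := by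
  rw [eval_momentTransform, Finset.sum_range_succ, Finset.sum_range_succ, Finset.sum_eq_zero,
    zero_add]
  · rw [Nat.sub_self, Nat.add_sub_cancel_left, ascPochhammer_zero, ascPochhammer_one, eval_one,
      eval_X, show -((M + 1 : ℕ) : ℝ) - β + 1 = -β - M by push_cast; ring,
      ascPochhammer_succ_eval]
    push_cast
    ring
  · intro k hk
    obtain ⟨m, rfl⟩ := Nat.exists_eq_add_of_lt (Finset.mem_range.1 hk)
    rw [show -((k + m + 1 + 1 : ℕ) : ℝ) - β + (β + k + 2) = -(m : ℝ) by push_cast; ring,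
      ascPochhammer_eval_neg_coe_nat_of_lt (by lia), mul_zero, mul_zero]

theorem ascPochhammer_eval_neg_sub_ne_zero (hβ : -1 < β) (N : ℕ) :
    (ascPochhammer ℝ N).eval (-β - N) ≠ 0 := by
  rw [Ne, ascPochhammer_eval_eq_zero_iff]
  rintro ⟨k, hk, h⟩
  have : (k : ℝ) + 1 ≤ N := by exact_mod_cast hk
  linarith

end MomentTransform

/-! ### Multi-indices and their nodes -/

section MultiIndex

variable {r : ℕ}

theorem size_add_single (n : Fin r → ℕ) (j : Fin r) : size (n + Pi.single j 1) = size n + 1 := by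
  simp [size, Finset.sum_add_distrib]

theorem le_size (n : Fin r → ℕ) (j : Fin r) : n j ≤ size n :=
  Finset.single_le_sum (fun _ _ => Nat.zero_le _) (Finset.mem_univ j)

theorem exists_eq_add_single {n : Fin r → ℕ} {j : Fin r} (hj : n j ≠ 0) :
    ∃ m : Fin r → ℕ, n = m + Pi.single j 1 := by
  refine ⟨n - Pi.single j 1, (tsub_add_cancel_of_le fun i => ?_).symm⟩
  rcases eq_or_ne i j with rfl | hij
  · rw [Pi.single_eq_same]
    exact Nat.one_le_iff_ne_zero.2 hj
  · rw [Pi.single_eq_of_ne hij]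
    exact Nat.zero_le _

theorem size_sub_single_lt {n : Fin r → ℕ} {j : Fin r} (hj : n j ≠ 0) :
    size (n - Pi.single j 1) < size n := by
  obtain ⟨m, rfl⟩ := exists_eq_add_single hj
  rw [add_tsub_cancel_right, size_add_single]
  exact Nat.lt_succ_self _

end MultiIndex

section Nodes

variable {r : ℕ} {α : Fin r → ℝ} {β z : ℝ}

/-- The differences `α i - α j` with `i ≠ j` are not integers. -/
def NonIntegerGaps (α : Fin r → ℝ) : Prop :=
  Pairwise fun i j => ∀ m : ℤ, α i - α j ≠ m

/-- The exponents `α j + k`, `k < n j`, of the orthogonality conditions for the multi-index `n`. -/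
def nodes (α : Fin r → ℝ) (n : Fin r → ℕ) (x : Σ j, Fin (n j)) : ℝ :=
  α x.1 + (x.2 : ℕ)

/-- The monic polynomial whose roots are the exponents `α j + k`, `k < n j`. -/
def nodalPoly (α : Fin r → ℝ) (n : Fin r → ℕ) : ℝ[X] :=
  Lagrange.nodal Finset.univ (nodes α n)

theorem NonIntegerGaps.add_natCast_ne (hgap : NonIntegerGaps α) {i j : Fin r} (hij : i ≠ j)
    (k l : ℕ) : α i + k ≠ α j + l := fun h =>
  hgap hij (l - k) (by push_cast; linarith)

theorem NonIntegerGaps.injective_nodes (hgap : NonIntegerGaps α) (n : Fin r → ℕ) :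
    Function.Injective (nodes α n) := by
  rintro ⟨i, k⟩ ⟨j, l⟩ hkl
  rcases eq_or_ne i j with rfl | hij
  · exact congrArg (Sigma.mk i) (Fin.ext (Nat.cast_injective (add_left_cancel hkl)))
  · exact absurd hkl (hgap.add_natCast_ne hij _ _)

theorem card_sigma_fin_eq_size (n : Fin r → ℕ) : Fintype.card (Σ j, Fin (n j)) = size n := by
  simp only [Fintype.card_sigma, Fintype.card_fin, size]

theorem NonIntegerGaps.eq_zero_of_eval_nodes (hgap : NonIntegerGaps α) {n : Fin r → ℕ} {p : ℝ[X]}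
    (hp : p.degree < size n) (heval : ∀ x, p.eval (nodes α n x) = 0) : p = 0 := by
  refine eq_zero_of_degree_lt_of_eval_index_eq_zero Finset.univ (hgap.injective_nodes n).injOn ?_
    fun x _ => heval x
  rwa [Finset.card_univ, card_sigma_fin_eq_size]

theorem monic_nodalPoly (α : Fin r → ℝ) (n : Fin r → ℕ) : (nodalPoly α n).Monic :=
  Lagrange.nodal_monic

theorem natDegree_nodalPoly (α : Fin r → ℝ) (n : Fin r → ℕ) :
    (nodalPoly α n).natDegree = size n := by
  rw [nodalPoly, Lagrange.natDegree_nodal, Finset.card_univ, card_sigma_fin_eq_size]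

theorem eval_nodalPoly_nodes (α : Fin r → ℝ) (n : Fin r → ℕ) (x : Σ j, Fin (n j)) :
    (nodalPoly α n).eval (nodes α n x) = 0 :=
  Lagrange.eval_nodal_at_node (Finset.mem_univ x)

theorem eval_nodalPoly_ne_zero {n : Fin r → ℕ} (hz : ∀ x, z ≠ nodes α n x) :
    (nodalPoly α n).eval z ≠ 0 :=
  Lagrange.eval_nodal_not_at_node fun x _ => hz x

theorem NonIntegerGaps.eval_nodalPoly_ne_zero (hgap : NonIntegerGaps α) (n : Fin r → ℕ)
    (j : Fin r) : (nodalPoly α n).eval (α j + n j) ≠ 0 := by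
  refine JacobiPineiro.eval_nodalPoly_ne_zero fun ⟨i, k⟩ h => ?_
  rcases eq_or_ne j i with rfl | hij
  · exact k.2.ne' (Nat.cast_injective (add_left_cancel h))
  · exact hgap.add_natCast_ne hij _ _ h

theorem eval_nodalPoly_neg_sub_one_ne_zero (hα : ∀ j, -1 < α j) (hβ : -1 < β) (n : Fin r → ℕ) :
    (nodalPoly α n).eval (-size n - β - 1) ≠ 0 := by
  refine eval_nodalPoly_ne_zero fun ⟨j, k⟩ => ne_of_lt ?_
  have hsize : (k : ℝ) + 1 ≤ size n := by exact_mod_cast k.2.trans_le (le_size n j)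
  rw [nodes]
  linarith [hα j, (k : ℕ).cast_nonneg (α := ℝ)]

theorem eval_nodalPoly (α : Fin r → ℝ) (n : Fin r → ℕ) (z : ℝ) :
    (nodalPoly α n).eval z = ∏ j, (descPochhammer ℝ (n j)).eval (z - α j) := by
  rw [nodalPoly, Lagrange.eval_nodal, Fintype.prod_sigma]
  refine Finset.prod_congr rfl fun j _ => ?_
  rw [descPochhammer_eval_eq_prod_range, ← Fin.prod_univ_eq_prod_range]
  simp only [nodes, sub_sub]

theorem eval_nodalPoly_add_single (α : Fin r → ℝ) (n : Fin r → ℕ) (j : Fin r) (z : ℝ) :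
    (nodalPoly α (n + Pi.single j 1)).eval z = (nodalPoly α n).eval z * (z - α j - n j) := by
  have hfactor (i : Fin r) :
      (descPochhammer ℝ ((n + Pi.single j 1 : Fin r → ℕ) i)).eval (z - α i) =
        (descPochhammer ℝ (n i)).eval (z - α i) * if i = j then z - α i - n i else 1 := by
    split_ifs with hij
    · rw [hij, Pi.add_apply, Pi.single_eq_same, descPochhammer_succ_eval]
    · rw [Pi.add_apply, Pi.single_eq_of_ne hij, add_zero, mul_one]
  rw [eval_nodalPoly, eval_nodalPoly, Finset.prod_congr rfl fun i _ => hfactor i,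
    Finset.prod_mul_distrib, Finset.prod_ite_eq' Finset.univ j, if_pos (Finset.mem_univ j)]

theorem eval_q (α : Fin r → ℝ) (z : ℝ) : (q α).eval z = ∏ j, (z - α j) := by
  simp only [q, eval_prod, eval_sub, eval_X, eval_C]

theorem eval_Q (α : Fin r → ℝ) (n : Fin r → ℕ) (z : ℝ) :
    (Q α n).eval z = ∏ j, (z - α j - n j) := by
  simp only [Q, eval_prod, eval_sub, eval_X, eval_C, sub_sub, add_comm]

/-- Factor by factor this is the identity
`x (x - 1) ⋯ (x - m + 1) (x - m) = x ((x - 1) ⋯ (x - m))` for the falling factorials. -/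
theorem eval_nodalPoly_mul_eval_Q (α : Fin r → ℝ) (n : Fin r → ℕ) (z : ℝ) :
    (nodalPoly α n).eval z * (Q α n).eval z = (q α).eval z * (nodalPoly α n).eval (z - 1) := by
  rw [eval_nodalPoly, eval_nodalPoly, eval_Q, eval_q, ← Finset.prod_mul_distrib,
    ← Finset.prod_mul_distrib]
  refine Finset.prod_congr rfl fun j _ => ?_
  rw [← descPochhammer_succ_eval, descPochhammer_succ_left, sub_right_comm z 1]
  simp only [eval_mul, eval_X, eval_comp, eval_sub, eval_one]

theorem eval_nodalPoly_eq_quot_mul {n : Fin r → ℕ} (hz : (Q α n).eval z ≠ 0) :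
    (nodalPoly α n).eval z = quot α n z * (nodalPoly α n).eval (z - 1) := by
  rw [quot, div_mul_eq_mul_div, eq_div_iff hz, eval_nodalPoly_mul_eval_Q]

theorem NonIntegerGaps.eval_nodalPoly_shift (hgap : NonIntegerGaps α) (m : Fin r → ℕ) (j : Fin r) :
    (nodalPoly α (m + Pi.single j 1)).eval (α j + m j + 1) =
      (∏ i ∈ Finset.univ.erase j, (m j + 1 + α j - α i) / (m j + 1 - m i + α j - α i)) *
        (m j + 1) * (nodalPoly α m).eval (α j + m j) := by
  have hQ : (Q α m).eval (α j + m j + 1) =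
      ∏ i ∈ Finset.univ.erase j, (m j + 1 - m i + α j - α i) := by
    rw [eval_Q, ← Finset.mul_prod_erase _ _ (Finset.mem_univ j),
      show α j + m j + 1 - α j - m j = 1 by ring, one_mul]
    exact Finset.prod_congr rfl fun i _ => by ring
  have hq : (q α).eval (α j + m j + 1) =
      (m j + 1) * ∏ i ∈ Finset.univ.erase j, (m j + 1 + α j - α i) := by
    rw [eval_q, ← Finset.mul_prod_erase _ _ (Finset.mem_univ j)]
    congr 1
    · ring
    · exact Finset.prod_congr rfl fun i _ => by ring
  have hQ0 : (Q α m).eval (α j + m j + 1) ≠ 0 := by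
    rw [hQ]
    refine Finset.prod_ne_zero_iff.2 fun i hi h => ?_
    refine hgap.add_natCast_ne (Finset.ne_of_mem_erase hi) (m i) (m j + 1) ?_
    push_cast
    linarith
  rw [eval_nodalPoly_add_single, eval_nodalPoly_eq_quot_mul hQ0, quot, hq, hQ,
    Finset.prod_div_distrib, add_sub_cancel_right]
  ring

end Nodes

/-! ### Existence and uniqueness of the Jacobi–Piñeiro polynomials -/

section TypeII

variable {r : ℕ} {α : Fin r → ℝ} {β : ℝ} {n : Fin r → ℕ} {p p' : ℝ[X]}

theorem neg_one_lt_nodes (hα : ∀ j, -1 < α j) (n : Fin r → ℕ) (x : Σ j, Fin (n j)) :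
    -1 < nodes α n x := by
  rw [nodes]
  linarith [hα x.1, (x.2 : ℕ).cast_nonneg (α := ℝ)]

theorem isTypeII_iff_betaMoment_nodes (hα : ∀ j, -1 < α j) (hβ : -1 < β) :
    IsTypeII α β n p ↔
      p.Monic ∧ p.natDegree = size n ∧ ∀ x, betaMoment β (nodes α n x) p = 0 := by
  constructor
  · rintro ⟨hmonic, hdeg, horth⟩
    exact ⟨hmonic, hdeg, fun x => (integral_eval_mul_pow_mul (hα x.1) hβ x.2 p).symm.trans
      (horth x.1 x.2 x.2.2)⟩
  · rintro ⟨hmonic, hdeg, hmoment⟩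
    exact ⟨hmonic, hdeg, fun j k hk => (integral_eval_mul_pow_mul (hα j) hβ k p).trans
      (hmoment ⟨j, k, hk⟩)⟩

theorem IsTypeII.betaMoment_nodes (hp : IsTypeII α β n p) (hα : ∀ j, -1 < α j) (hβ : -1 < β)
    (x : Σ j, Fin (n j)) : betaMoment β (nodes α n x) p = 0 :=
  ((isTypeII_iff_betaMoment_nodes hα hβ).1 hp).2.2 x

theorem eval_momentTransform_eq_zero (hβ : -1 < β) {s : ℝ} (hs : -1 < s) {N : ℕ}
    (hp : p.natDegree ≤ N) (hmoment : betaMoment β s p = 0) :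
    (momentTransform β N p).eval s = 0 := by
  rw [betaMoment_eq_gammaFactor_mul hs hβ hp] at hmoment
  exact (mul_eq_zero.1 hmoment).resolve_left (gammaFactor_pos hs hβ N).ne'

theorem NonIntegerGaps.eq_zero_of_betaMoment_nodes (hgap : NonIntegerGaps α)
    (hα : ∀ j, -1 < α j) (hβ : -1 < β) (hp : p.degree < size n)
    (hmoment : ∀ x, betaMoment β (nodes α n x) p = 0) : p = 0 := by
  by_contra hp0
  have htransform : momentTransform β p.natDegree p = 0 := by
    refine hgap.eq_zero_of_eval_nodes (n := n) ?_ fun x =>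
      eval_momentTransform_eq_zero hβ (neg_one_lt_nodes hα n x) le_rfl (hmoment x)
    refine degree_le_natDegree.trans_lt (Nat.cast_lt.2 ?_)
    exact (natDegree_momentTransform_le _ _ _).trans_lt ((natDegree_lt_iff_degree_lt hp0).2 hp)
  have hlead := eval_momentTransform_neg_sub_one β p.natDegree p
  rw [htransform, eval_zero] at hlead
  exact mul_ne_zero (leadingCoeff_ne_zero.2 hp0)
    (ascPochhammer_eval_neg_sub_ne_zero hβ _) hlead.symm

theorem exists_isTypeII (hα : ∀ j, -1 < α j) (hβ : -1 < β) (hgap : NonIntegerGaps α)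
    (n : Fin r → ℕ) : ∃ p, IsTypeII α β n p := by
  let moments : degreeLT ℝ (size n) →ₗ[ℝ] (Σ j, Fin (n j)) → ℝ :=
    LinearMap.pi fun x => betaMoment β (nodes α n x) ∘ₗ (degreeLT ℝ (size n)).subtype
  have hinjective : Function.Injective moments :=
    (injective_iff_map_eq_zero moments).2 fun p hp => Subtype.ext <|
      hgap.eq_zero_of_betaMoment_nodes hα hβ (mem_degreeLT.1 p.2) fun x => congrFun hp x
  have : FiniteDimensional ℝ (degreeLT ℝ (size n)) := (degreeLTEquiv ℝ _).symm.finiteDimensional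
  have hfinrank : Module.finrank ℝ (degreeLT ℝ (size n)) =
      Module.finrank ℝ ((Σ j, Fin (n j)) → ℝ) := by
    rw [(degreeLTEquiv ℝ (size n)).finrank_eq, Module.finrank_fin_fun,
      Module.finrank_fintype_fun_eq_card, card_sigma_fin_eq_size]
  obtain ⟨⟨p, hp⟩, hpX⟩ :=
    (LinearMap.injective_iff_surjective_of_finrank_eq_finrank hfinrank).1 hinjective
      fun x => betaMoment β (nodes α n x) (X ^ size n)
  rw [mem_degreeLT] at hp
  refine ⟨X ^ size n - p, (isTypeII_iff_betaMoment_nodes hα hβ).2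
    ⟨monic_X_pow_sub hp, ?_, fun x => ?_⟩⟩
  · refine natDegree_eq_of_degree_eq_some ?_
    rw [degree_sub_eq_left_of_degree_lt (hp.trans_eq (degree_X_pow _).symm), degree_X_pow]
  · rw [map_sub, sub_eq_zero]
    exact (congrFun hpX x).symm

theorem IsTypeII.unique (hp : IsTypeII α β n p) (hp' : IsTypeII α β n p') (hα : ∀ j, -1 < α j)
    (hβ : -1 < β) (hgap : NonIntegerGaps α) : p = p' := by
  refine sub_eq_zero.1 (hgap.eq_zero_of_betaMoment_nodes hα hβ (n := n) ?_ fun x => ?_)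
  · rw [← hp.natDegree_eq, ← degree_eq_natDegree hp.monic.ne_zero]
    refine degree_sub_lt_left ?_ hp.monic.ne_zero (hp.monic.trans hp'.monic.symm)
    rw [degree_eq_natDegree hp.monic.ne_zero, degree_eq_natDegree hp'.monic.ne_zero,
      hp.natDegree_eq, hp'.natDegree_eq]
  · rw [map_sub, hp.betaMoment_nodes hα hβ, hp'.betaMoment_nodes hα hβ, sub_zero]

end TypeII

/-! ### Explicit moments and the subleading coefficient -/

section ExplicitMoments

variable {r : ℕ} {α : Fin r → ℝ} {β : ℝ} {n : Fin r → ℕ} {p : ℝ[X]}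

/-- The factor by which the moment transform of the Jacobi–Piñeiro polynomial differs from the
nodal polynomial. -/
def nodalScale (α : Fin r → ℝ) (β : ℝ) (n : Fin r → ℕ) : ℝ :=
  (ascPochhammer ℝ (size n)).eval (-β - size n) / (nodalPoly α n).eval (-size n - β - 1)

theorem nodalScale_ne_zero (hα : ∀ j, -1 < α j) (hβ : -1 < β) (n : Fin r → ℕ) :
    nodalScale α β n ≠ 0 :=
  div_ne_zero (ascPochhammer_eval_neg_sub_ne_zero hβ _)
    (eval_nodalPoly_neg_sub_one_ne_zero hα hβ n)

theorem ascPochhammer_succ_eval_neg_sub (β : ℝ) (N : ℕ) :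
    (ascPochhammer ℝ (N + 1)).eval (-β - (N + 1 : ℕ)) =
      -(N + 1 + β) * (ascPochhammer ℝ N).eval (-β - N) := by
  rw [ascPochhammer_succ_left, eval_mul, eval_X, eval_comp, eval_add, eval_X, eval_one,
    Nat.cast_succ, show -β - (N + 1 : ℝ) + 1 = -β - N by ring]
  ring

theorem nodalScale_add_single (hα : ∀ j, -1 < α j) (hβ : -1 < β) (m : Fin r → ℕ) (j : Fin r) :
    nodalScale α β (m + Pi.single j 1) = nodalScale α β m *
      (-(size m + 1 + β) * (nodalPoly α m).eval (-size m - β - 1) /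
        (nodalPoly α (m + Pi.single j 1)).eval (-size (m + Pi.single j 1) - β - 1)) := by
  have hm := eval_nodalPoly_neg_sub_one_ne_zero hα hβ m
  rw [nodalScale, nodalScale, size_add_single, ascPochhammer_succ_eval_neg_sub]
  field_simp

theorem NonIntegerGaps.eq_C_mul_nodalPoly (hgap : NonIntegerGaps α) (hp : p.natDegree ≤ size n)
    (heval : ∀ x, p.eval (nodes α n x) = 0) : p = C (p.coeff (size n)) * nodalPoly α n := by
  refine sub_eq_zero.1 (hgap.eq_zero_of_eval_nodes (n := n) ?_ fun x => ?_)
  · have hlead : (nodalPoly α n).coeff (size n) = 1 := by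
      rw [← natDegree_nodalPoly α n]
      exact monic_nodalPoly α n
    refine (degree_lt_iff_coeff_zero _ _).2 fun k hk => ?_
    rw [coeff_sub, coeff_C_mul]
    rcases hk.eq_or_lt with rfl | hk
    · rw [hlead, mul_one, sub_self]
    · rw [coeff_eq_zero_of_natDegree_lt (hp.trans_lt hk), coeff_eq_zero_of_natDegree_lt
        ((natDegree_nodalPoly α n).trans_lt hk), mul_zero, sub_zero]
  · rw [eval_sub, eval_mul, heval, eval_nodalPoly_nodes, mul_zero, sub_zero]

theorem IsTypeII.coeff_size (hp : IsTypeII α β n p) : p.coeff (size n) = 1 := by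
  rw [← hp.natDegree_eq]
  exact hp.monic

theorem IsTypeII.momentTransform_eq (hp : IsTypeII α β n p) (hα : ∀ j, -1 < α j) (hβ : -1 < β)
    (hgap : NonIntegerGaps α) :
    momentTransform β (size n) p = C (nodalScale α β n) * nodalPoly α n := by
  have hmultiple := hgap.eq_C_mul_nodalPoly (natDegree_momentTransform_le β (size n) p) fun x =>
    eval_momentTransform_eq_zero hβ (neg_one_lt_nodes hα n x) hp.natDegree_eq.le
      (hp.betaMoment_nodes hα hβ x)
  have hscale := eval_momentTransform_neg_sub_one β (size n) p
  rw [hmultiple, eval_mul, eval_C, hp.coeff_size, one_mul,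
    ← eq_div_iff (eval_nodalPoly_neg_sub_one_ne_zero hα hβ n), ← nodalScale] at hscale
  rw [hmultiple, hscale]

theorem IsTypeII.betaMoment_eq (hp : IsTypeII α β n p) (hα : ∀ j, -1 < α j) (hβ : -1 < β)
    (hgap : NonIntegerGaps α) {s : ℝ} (hs : -1 < s) :
    betaMoment β s p =
      gammaFactor β (size n) s * (nodalScale α β n * (nodalPoly α n).eval s) := by
  rw [betaMoment_eq_gammaFactor_mul hs hβ hp.natDegree_eq.le, hp.momentTransform_eq hα hβ hgap,
    eval_mul, eval_C]

theorem IsTypeII.betaMoment_ne_zero (hp : IsTypeII α β n p) (hα : ∀ j, -1 < α j) (hβ : -1 < β)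
    (hgap : NonIntegerGaps α) (j : Fin r) : betaMoment β (α j + n j) p ≠ 0 := by
  have hs : -1 < α j + n j := by linarith [hα j, (n j).cast_nonneg (α := ℝ)]
  rw [hp.betaMoment_eq hα hβ hgap hs]
  exact mul_ne_zero (gammaFactor_pos hs hβ _).ne'
    (mul_ne_zero (nodalScale_ne_zero hα hβ n) (hgap.eval_nodalPoly_ne_zero n j))

/-- The subleading coefficient of the Jacobi–Piñeiro polynomial. In contrast to `deltaFormula`, no
denominator vanishes in the range `α j, β > -1`. -/
def delta (α : Fin r → ℝ) (β : ℝ) (n : Fin r → ℕ) : ℝ :=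
  -(size n + β) * ((nodalPoly α n).eval (-size n - β) / (nodalPoly α n).eval (-size n - β - 1)) + β

theorem IsTypeII.nextCoeff_eq_delta (hp : IsTypeII α β n p) (hα : ∀ j, -1 < α j) (hβ : -1 < β)
    (hgap : NonIntegerGaps α) : p.nextCoeff = delta α β n := by
  rw [delta]
  rcases hN : size n with _ | M
  · have hnodal : nodalPoly α n = 1 :=
      eq_one_of_monic_natDegree_zero (monic_nodalPoly α n) ((natDegree_nodalPoly α n).trans hN)
    have hone : p = 1 := eq_one_of_monic_natDegree_zero hp.monic (hp.natDegree_eq.trans hN)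
    simp [hone, hnodal, nextCoeff]
  · have hdeg : p.natDegree = M + 1 := hp.natDegree_eq.trans hN
    have hcoeff : p.nextCoeff = p.coeff M := by
      rw [nextCoeff_of_natDegree_pos (hdeg ▸ M.succ_pos), hdeg, Nat.add_sub_cancel]
    have htransform := eval_momentTransform_neg β M p
    rw [← hN, hp.momentTransform_eq hα hβ hgap, hp.coeff_size, eval_mul, eval_C, nodalScale, hN,
      ascPochhammer_succ_eval_neg_sub] at htransform
    have hasc := ascPochhammer_eval_neg_sub_ne_zero hβ M
    have hnodal := eval_nodalPoly_neg_sub_one_ne_zero hα hβ n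
    rw [hN] at hnodal
    rw [hcoeff]
    refine eq_add_of_sub_eq (mul_right_cancel₀ hasc ?_)
    rw [mul_one] at htransform
    rw [← htransform]
    push_cast
    ring

/-- The recurrence coefficient `a_{n,j}`. In contrast to `aFormula`, no denominator vanishes in the
range `α j, β > -1`; for `n j = 0` the second factor is `0`. -/
def aCoeff (α : Fin r → ℝ) (β : ℝ) (n : Fin r → ℕ) (j : Fin r) : ℝ :=
  (∏ i ∈ Finset.univ.erase j, ((n j : ℝ) + α j - α i) / ((n j : ℝ) - n i + α j - α i)) *
    (n j * (n j + α j) * (size n + β) /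
      ((size n + n j + α j + β + 1) * (size n + n j + α j + β))) *
    -((nodalPoly α (n - Pi.single j 1)).eval (-size n - β) /
      (nodalPoly α n).eval (-size n - β - 1))

theorem aCoeff_add_single (α : Fin r → ℝ) (β : ℝ) (m : Fin r → ℕ) (j : Fin r) :
    aCoeff α β (m + Pi.single j 1) j =
      (∏ i ∈ Finset.univ.erase j, (m j + 1 + α j - α i) / (m j + 1 - m i + α j - α i)) *
      ((m j + 1) * (m j + 1 + α j) * (size m + 1 + β) /
        ((size m + m j + α j + β + 3) * (size m + m j + α j + β + 2))) *
      -((nodalPoly α m).eval (-size m - β - 1) /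
        (nodalPoly α (m + Pi.single j 1)).eval (-size (m + Pi.single j 1) - β - 1)) := by
  have hprod : ∏ i ∈ Finset.univ.erase j, (((m + Pi.single j 1 : Fin r → ℕ) j : ℝ) + α j - α i) /
        (((m + Pi.single j 1 : Fin r → ℕ) j : ℝ) - (m + Pi.single j 1 : Fin r → ℕ) i + α j - α i) =
      ∏ i ∈ Finset.univ.erase j, (m j + 1 + α j - α i) / (m j + 1 - m i + α j - α i) := by
    refine Finset.prod_congr rfl fun i hi => ?_
    simp [Finset.ne_of_mem_erase hi]
  rw [aCoeff, hprod, add_tsub_cancel_right, Pi.add_apply, Pi.single_eq_same, size_add_single]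
  push_cast
  ring_nf

theorem IsTypeII.betaMoment_add_single {m : Fin r → ℕ} {j : Fin r} {p' : ℝ[X]}
    (hp : IsTypeII α β (m + Pi.single j 1) p) (hp' : IsTypeII α β m p') (hα : ∀ j, -1 < α j)
    (hβ : -1 < β) (hgap : NonIntegerGaps α) :
    betaMoment β (α j + m j + 1) p =
      aCoeff α β (m + Pi.single j 1) j * betaMoment β (α j + m j) p' := by
  have hs : -1 < α j + m j := by linarith [hα j, (m j).cast_nonneg (α := ℝ)]
  rw [hp.betaMoment_eq hα hβ hgap (by linarith), hp'.betaMoment_eq hα hβ hgap hs,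
    nodalScale_add_single hα hβ, hgap.eval_nodalPoly_shift, aCoeff_add_single,
    size_add_single m j, gammaFactor_succ hs hβ]
  rw [show α j + m j + β + size m + 2 = size m + m j + α j + β + 2 by ring,
    show α j + m j + β + size m + 3 = size m + m j + α j + β + 3 by ring]
  ring

end ExplicitMoments

/-! ### The nearest-neighbor recurrence -/

theorem degree_X_mul_sub_sub_C_mul_lt {R : Type*} [Ring R] {p p' : R[X]} (hp : p.Monic)
    (hp' : p'.Monic) (hdeg : p'.natDegree = p.natDegree + 1) :
    (X * p - p' - C (p.nextCoeff - p'.nextCoeff) * p).degree <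
      (p.natDegree : WithBot ℕ) := by
  have hnext : (X * p).coeff p.natDegree = p.nextCoeff := by
    rcases hd : p.natDegree with _ | d
    · rw [coeff_X_mul_zero, nextCoeff, if_pos hd]
    · rw [coeff_X_mul, nextCoeff_of_natDegree_pos (hd ▸ d.succ_pos), hd, Nat.add_sub_cancel]
  have hnext' : p'.coeff p.natDegree = p'.nextCoeff := by
    rw [nextCoeff_of_natDegree_pos (hdeg ▸ Nat.succ_pos _), hdeg, Nat.add_sub_cancel]
  have htop' : p'.coeff (p.natDegree + 1) = 1 := hdeg ▸ hp'
  refine (degree_lt_iff_coeff_zero _ _).2 fun m hm => ?_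
  rw [coeff_sub, coeff_sub, coeff_C_mul]
  rcases hm.eq_or_lt with rfl | hm
  · rw [hnext, hnext', hp.coeff_natDegree, mul_one, sub_self]
  obtain ⟨m, rfl⟩ := Nat.exists_eq_add_one_of_ne_zero (Nat.ne_zero_of_lt hm)
  rw [coeff_X_mul, coeff_eq_zero_of_natDegree_lt hm, mul_zero, sub_zero, sub_eq_zero]
  rcases (Nat.le_of_lt_succ hm).eq_or_lt with rfl | hm
  · rw [hp.coeff_natDegree, htop']
  · rw [coeff_eq_zero_of_natDegree_lt hm,
      coeff_eq_zero_of_natDegree_lt (hdeg.trans_lt (Nat.succ_lt_succ hm))]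

section Recurrence

variable {r : ℕ} {α : Fin r → ℝ} {β : ℝ} {P : (Fin r → ℕ) → ℝ[X]} {n : Fin r → ℕ}

/-- The lower-order part `∑_{j : n_j ≥ 1} c_j P_{n - e_j}` of the recurrence. -/
def loweringSum (P : (Fin r → ℕ) → ℝ[X]) (n : Fin r → ℕ) (c : Fin r → ℝ) : ℝ[X] :=
  ∑ j, if n j = 0 then 0 else C (c j) * P (n - Pi.single j 1)

theorem IsTypeII.betaMoment_eq_zero {p : ℝ[X]} (hp : IsTypeII α β n p) (hα : ∀ j, -1 < α j)
    (hβ : -1 < β) {j : Fin r} {k : ℕ} (hk : k < n j) : betaMoment β (α j + k) p = 0 :=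
  hp.betaMoment_nodes hα hβ ⟨j, k, hk⟩

theorem degree_loweringSum_lt (hP : ∀ n, IsTypeII α β n (P n)) (n : Fin r → ℕ)
    (c : Fin r → ℝ) : (loweringSum P n c).degree < size n := by
  refine mem_degreeLT.1 (Submodule.sum_mem _ fun j _ => mem_degreeLT.2 ?_)
  split_ifs with hj
  · rw [degree_zero]
    exact WithBot.bot_lt_coe _
  · refine degree_le_natDegree.trans_lt (Nat.cast_lt.2 ((natDegree_C_mul_le _ _).trans_lt ?_))
    rw [(hP _).natDegree_eq]
    exact size_sub_single_lt hj

theorem betaMoment_loweringSum (β s : ℝ) (P : (Fin r → ℕ) → ℝ[X]) (n : Fin r → ℕ)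
    (c : Fin r → ℝ) : betaMoment β s (loweringSum P n c) =
      ∑ j, if n j = 0 then 0 else c j * betaMoment β s (P (n - Pi.single j 1)) := by
  rw [loweringSum, map_sum]
  refine Finset.sum_congr rfl fun j _ => ?_
  rw [apply_ite (betaMoment β s), map_zero, betaMoment_C_mul]

theorem betaMoment_loweringSum_eq_zero (hP : ∀ n, IsTypeII α β n (P n)) (hα : ∀ j, -1 < α j)
    (hβ : -1 < β) (c : Fin r → ℝ) {j : Fin r} {k : ℕ} (hk : k + 1 < n j) :
    betaMoment β (α j + k) (loweringSum P n c) = 0 := by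
  rw [betaMoment_loweringSum]
  refine Finset.sum_eq_zero fun i _ => ?_
  have hlower : k < (n - Pi.single i 1 : Fin r → ℕ) j := by
    rcases eq_or_ne j i with rfl | hij
    · rw [Pi.sub_apply, Pi.single_eq_same]
      lia
    · rw [Pi.sub_apply, Pi.single_eq_of_ne hij]
      lia
  rw [(hP _).betaMoment_eq_zero hα hβ hlower, mul_zero, ite_self]

theorem betaMoment_loweringSum_add_single (hP : ∀ n, IsTypeII α β n (P n))
    (hα : ∀ j, -1 < α j) (hβ : -1 < β) (c : Fin r → ℝ) (m : Fin r → ℕ) (j : Fin r) :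
    betaMoment β (α j + m j) (loweringSum P (m + Pi.single j 1) c) =
      c j * betaMoment β (α j + m j) (P m) := by
  rw [betaMoment_loweringSum, Finset.sum_eq_single j]
  · rw [add_tsub_cancel_right, Pi.add_apply, Pi.single_eq_same, if_neg (Nat.succ_ne_zero _)]
  · intro i _ hij
    have hlower : m j < (m + Pi.single j 1 - Pi.single i 1 : Fin r → ℕ) j := by
      rw [Pi.sub_apply, Pi.add_apply, Pi.single_eq_same, Pi.single_eq_of_ne hij.symm]
      exact Nat.lt_succ_self _
    rw [(hP _).betaMoment_eq_zero hα hβ hlower, mul_zero, ite_self]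
  · exact fun hj => absurd (Finset.mem_univ j) hj

theorem isRecurrenceCoeff_aCoeff (hP : ∀ n, IsTypeII α β n (P n)) (hα : ∀ j, -1 < α j)
    (hβ : -1 < β) (hgap : NonIntegerGaps α) (n : Fin r → ℕ) :
    IsRecurrenceCoeff P n (aCoeff α β n)
      fun k => (P n).nextCoeff - (P (n + Pi.single k 1)).nextCoeff := by
  refine ⟨fun j hj => by simp [aCoeff, hj], fun k => ?_⟩
  change _ = _ + loweringSum P n (aCoeff α β n)
  rw [← sub_eq_iff_eq_add', ← sub_sub]
  refine sub_eq_zero.1 (hgap.eq_zero_of_betaMoment_nodes hα hβ (n := n) ?_ fun ⟨j, i, hi⟩ => ?_)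
  · refine (degree_sub_le _ _).trans_lt (max_lt ?_ (degree_loweringSum_lt hP n _))
    rw [← (hP n).natDegree_eq]
    refine degree_X_mul_sub_sub_C_mul_lt (hP n).monic (hP _).monic ?_
    rw [(hP n).natDegree_eq, (hP _).natDegree_eq, size_add_single]
  · have hraised : i < (n + Pi.single k 1 : Fin r → ℕ) j := hi.trans_le (Nat.le_add_right _ _)
    rw [nodes, map_sub, map_sub, map_sub, betaMoment_C_mul, betaMoment_X_mul,
      (hP n).betaMoment_eq_zero hα hβ hi, (hP _).betaMoment_eq_zero hα hβ hraised, mul_zero,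
      sub_zero, sub_zero, sub_eq_zero]
    rcases Nat.lt_or_ge (i + 1) (n j) with hi' | hi'
    · rw [betaMoment_loweringSum_eq_zero hP hα hβ _ hi', add_assoc, ← Nat.cast_succ,
        (hP n).betaMoment_eq_zero hα hβ hi']
    · obtain ⟨m, rfl⟩ := exists_eq_add_single (Nat.ne_zero_of_lt hi)
      rw [Pi.add_apply, Pi.single_eq_same] at hi hi'
      obtain rfl : i = m j := by lia
      rw [betaMoment_loweringSum_add_single hP hα hβ,
        (hP (m + Pi.single j 1)).betaMoment_add_single (hP m) hα hβ hgap]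

theorem IsRecurrenceCoeff.unique (hP : ∀ n, IsTypeII α β n (P n)) (hα : ∀ j, -1 < α j)
    (hβ : -1 < β) (hgap : NonIntegerGaps α) {a b a' b' : Fin r → ℝ}
    (h : IsRecurrenceCoeff P n a b) (h' : IsRecurrenceCoeff P n a' b') : a = a' ∧ b = b' := by
  have heq (k : Fin r) : P (n + Pi.single k 1) + C (b k) * P n + loweringSum P n a =
      P (n + Pi.single k 1) + C (b' k) * P n + loweringSum P n a' :=
    (h.recurrence k).symm.trans (h'.recurrence k)
  have hb : b = b' := funext fun k => by
    have hcoeff := congrArg (coeff · (size n)) (heq k)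
    simpa only [coeff_add, coeff_C_mul, (hP n).coeff_size, mul_one, add_right_inj,
      coeff_eq_zero_of_degree_lt (degree_loweringSum_lt hP n _), add_zero] using hcoeff
  refine ⟨funext fun j => ?_, hb⟩
  by_cases hj : n j = 0
  · rw [h.boundary j hj, h'.boundary j hj]
  obtain ⟨m, rfl⟩ := exists_eq_add_single hj
  have hlower := add_left_cancel ((hb ▸ heq) j)
  have hmoment := congrArg (betaMoment β (α j + m j)) hlower
  rw [betaMoment_loweringSum_add_single hP hα hβ, betaMoment_loweringSum_add_single hP hα hβ]
    at hmoment
  exact mul_right_cancel₀ ((hP m).betaMoment_ne_zero hα hβ hgap j) hmoment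

end Recurrence

/-! ### The closed formulas -/

theorem prod_erase_eq_prod_ite {ι M : Type*} [Fintype ι] [DecidableEq ι] [CommMonoid M] (i : ι)
    (f : ι → M) : ∏ j ∈ Finset.univ.erase i, f j = ∏ j, if j = i then 1 else f j := by
  rw [← Finset.prod_erase (a := i) Finset.univ (f := fun j => if j = i then 1 else f j)
    (if_pos rfl)]
  exact Finset.prod_congr rfl fun j hj => (if_neg (Finset.ne_of_mem_erase hj)).symm

theorem injective_add_one_self_sub_one {R : Type*} [Ring R] [NeZero (2 : R)]
    (z : R) : Function.Injective ![z + 1, z, z - 1] := by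
  have : Nontrivial R := nontrivial_of_ne 2 0 (NeZero.ne 2)
  have hends : z + 1 ≠ z - 1 := fun h =>
    NeZero.ne (2 : R) (by rw [← one_add_one_eq_two, ← sub_eq_zero.2 h]; abel)
  have hpred : z ≠ z - 1 := fun h => one_ne_zero (sub_eq_self.1 h.symm)
  rw [Matrix.vecCons, Fin.cons_injective_iff, Matrix.vecCons, Fin.cons_injective_iff]
  simp [hends, hpred, Function.injective_of_subsingleton]

/-- The divided difference of `F` at the `card ι + 3` nodes `x j`, `z + 1`, `z`, `z - 1` vanishes,
because the degree of `F` is too small. -/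
theorem sum_eval_div_prod_sub_mul {ι K : Type*} [Fintype ι] [DecidableEq ι] [Field K]
    [NeZero (2 : K)] {x : ι → K} (hx : Function.Injective x) {z : K}
    (hsucc : ∀ i, z + 1 ≠ x i) (hz : ∀ i, z ≠ x i) (hpred : ∀ i, z - 1 ≠ x i)
    {F : K[X]} (hF : F.natDegree ≤ Fintype.card ι + 1) :
    ∑ j, F.eval (x j) / ((∏ i ∈ Finset.univ.erase j, (x j - x i)) *
        ((x j - (z + 1)) * (x j - z) * (x j - (z - 1)))) =
      -(1 / 2) * (F.eval (z + 1) / ∏ i, (z + 1 - x i) - 2 * (F.eval z / ∏ i, (z - x i)) +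
        F.eval (z - 1) / ∏ i, (z - 1 - x i)) := by
  let v : ι ⊕ Fin 3 → K := Sum.elim x ![z + 1, z, z - 1]
  have hv : Function.Injective v := by
    refine hx.sumElim (injective_add_one_self_sub_one z) fun i k hik => ?_
    fin_cases k
    exacts [hsucc i hik.symm, hz i hik.symm, hpred i hik.symm]
  have hcard : (Finset.univ : Finset (ι ⊕ Fin 3)).card = Fintype.card ι + 3 := by
    rw [Finset.card_univ, Fintype.card_sum, Fintype.card_fin]
  have hdeg : F.degree < (Finset.univ : Finset (ι ⊕ Fin 3)).card := by
    rw [hcard]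
    exact degree_le_natDegree.trans_lt (Nat.cast_lt.2 (by lia))
  have hdivided := Lagrange.coeff_eq_sum hv.injOn hdeg
  rw [hcard, coeff_eq_zero_of_natDegree_lt (by lia), Fintype.sum_sum_type] at hdivided
  simp only [prod_erase_eq_prod_ite, Fintype.prod_sum_type, Fin.sum_univ_three,
    Fin.prod_univ_three] at hdivided ⊢
  simp only [Sum.elim_inl, Sum.inl.injEq, Fin.isValue, reduceCtorEq, ↓reduceIte, Sum.elim_inr,
    Matrix.cons_val_zero, Matrix.cons_val_one, Matrix.cons_val, Sum.inr.injEq, one_ne_zero,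
    add_sub_cancel_left, mul_one, Fin.reduceEq, add_sub_sub_cancel, one_mul, zero_ne_one,
    sub_add_cancel_left, sub_sub_cancel, mul_neg, sub_sub_cancel_left, neg_sub, v] at hdivided
  rw [one_add_one_eq_two, div_neg, div_mul_eq_div_div, div_mul_eq_div_div] at hdivided
  linear_combination -hdivided - F.eval z / (∏ i, (z - x i)) * mul_inv_cancel₀ (NeZero.ne (2 : K))

section Formulas

variable {r : ℕ} {α : Fin r → ℝ} {β : ℝ} {n : Fin r → ℕ}

theorem eval_Q_ne_zero_iff {z : ℝ} : (Q α n).eval z ≠ 0 ↔ ∀ i, z ≠ α i + n i := by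
  simp only [eval_Q, Finset.prod_ne_zero_iff, Finset.mem_univ, true_imp_iff, sub_sub, sub_ne_zero]

theorem natDegree_X_mul_q (α : Fin r → ℝ) : (X * q α).natDegree = r + 1 := by
  have hq : (q α).Monic := monic_prod_X_sub_C α Finset.univ
  rw [natDegree_X_mul hq.ne_zero, q, natDegree_finsetProd_X_sub_C_eq_card,
    Finset.card_univ, Fintype.card_fin]

theorem prod_div_eq_quot (α : Fin r → ℝ) (β : ℝ) (n : Fin r → ℕ) :
    (∏ i, ((size n : ℝ) + α i + β) / ((size n : ℝ) + n i + α i + β)) =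
      quot α n (-(size n : ℝ) - β) := by
  rw [quot, eval_q, eval_Q, ← Finset.prod_div_distrib]
  refine Finset.prod_congr rfl fun i _ => ?_
  rw [← neg_div_neg_eq]
  congr 1 <;> ring

theorem delta_eq_deltaFormula (hα : ∀ j, -1 < α j) (hβ : -1 < β)
    (hQ : (Q α n).eval (-size n - β) ≠ 0) : delta α β n = deltaFormula α β n := by
  rw [delta, deltaFormula, eval_nodalPoly_eq_quot_mul hQ,
    mul_div_cancel_right₀ _ (eval_nodalPoly_neg_sub_one_ne_zero hα hβ n)]

theorem eval_nodalPoly_sub_single {j : Fin r} (hj : n j ≠ 0) (z : ℝ) :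
    (nodalPoly α n).eval z = (nodalPoly α (n - Pi.single j 1)).eval z * (z - α j - n j + 1) := by
  obtain ⟨m, rfl⟩ := exists_eq_add_single hj
  rw [eval_nodalPoly_add_single, add_tsub_cancel_right, Pi.add_apply, Pi.single_eq_same]
  push_cast
  ring

theorem aCoeff_eq_aFormula (hα : ∀ j, -1 < α j) (hβ : -1 < β) {j : Fin r}
    (hQ : (Q α n).eval (-size n - β) ≠ 0) (hpred : size n + n j + α j + β - 1 ≠ 0) :
    aCoeff α β n j = aFormula α β n j := by
  by_cases hj : n j = 0
  · simp [aCoeff, aFormula, hj]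
  have hquot : quot α n (-size n - β) = (size n + n j + α j + β - 1) *
      -((nodalPoly α (n - Pi.single j 1)).eval (-size n - β) /
        (nodalPoly α n).eval (-size n - β - 1)) := by
    rw [← neg_div, ← mul_div_assoc, eq_div_iff (eval_nodalPoly_neg_sub_one_ne_zero hα hβ n),
      ← eval_nodalPoly_eq_quot_mul hQ, eval_nodalPoly_sub_single hj]
    ring
  rw [aFormula, prod_div_eq_quot, hquot, aCoeff, ← div_div _ _ (size n + n j + α j + β - 1),
    mul_assoc _ (_ * _) (_ / _), mul_right_comm (size n + n j + α j + β - 1),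
    mul_div_cancel₀ _ hpred, mul_assoc]

theorem aFormula_eq_div_prod_sub (α : Fin r → ℝ) (β : ℝ) (n : Fin r → ℕ) (j : Fin r) :
    aFormula α β n j = (size n + β) * quot α n (-size n - β) *
      ((X * q α).eval (α j + n j) / ((∏ i ∈ Finset.univ.erase j, (α j + n j - (α i + n i))) *
        ((α j + n j - (-size n - β + 1)) * (α j + n j - (-size n - β)) *
          (α j + n j - (-size n - β - 1))))) := by
  have hq : (q α).eval (α j + n j) = n j * ∏ i ∈ Finset.univ.erase j, (n j + α j - α i) := by
    rw [eval_q, ← Finset.mul_prod_erase _ _ (Finset.mem_univ j), add_sub_cancel_left, add_comm]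
  have hdenominator : ∏ i ∈ Finset.univ.erase j, ((n j : ℝ) - n i + α j - α i) =
      ∏ i ∈ Finset.univ.erase j, (α j + n j - (α i + n i)) :=
    Finset.prod_congr rfl fun i _ => by ring
  rw [aFormula, prod_div_eq_quot, Finset.prod_div_distrib, hdenominator, eval_mul, eval_X, hq,
    show α j + n j - (-size n - β + 1) = size n + n j + α j + β - 1 by ring,
    show α j + n j - (-size n - β) = size n + n j + α j + β by ring,
    show α j + n j - (-size n - β - 1) = size n + n j + α j + β + 1 by ring]
  simp only [div_eq_mul_inv, mul_inv]
  ring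

theorem sum_aFormula (hgap : NonIntegerGaps α) (hQ : (Q α n).eval (-size n - β) ≠ 0)
    (hQpred : (Q α n).eval (-size n - β - 1) ≠ 0) (hQsucc : (Q α n).eval (-size n - β + 1) ≠ 0) :
    ∑ j, aFormula α β n j = sumFormula α β n := by
  have hnodes : Function.Injective fun j => α j + n j := fun i j hij => by
    by_contra hne
    exact hgap.add_natCast_ne hne (n i) (n j) hij
  have hQeval (z : ℝ) : ∏ i, (z - (α i + n i)) = (Q α n).eval z := by
    simp only [eval_Q, sub_sub]
  have hquot (z : ℝ) : (X * q α).eval z / (Q α n).eval z = z * quot α n z := by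
    rw [eval_mul, eval_X, quot, mul_div_assoc]
  have hdivided := sum_eval_div_prod_sub_mul hnodes (eval_Q_ne_zero_iff.1 hQsucc)
    (eval_Q_ne_zero_iff.1 hQ) (eval_Q_ne_zero_iff.1 hQpred)
    ((natDegree_X_mul_q α).le.trans_eq (by rw [Fintype.card_fin]))
  simp only [hQeval, hquot] at hdivided
  rw [sumFormula, secondDiff, ← hdivided, Finset.mul_sum]
  exact Finset.sum_congr rfl fun j _ => aFormula_eq_div_prod_sub α β n j

theorem sum_aCoeff_eq_sumFormula (hα : ∀ j, -1 < α j) (hβ : -1 < β) (hgap : NonIntegerGaps α)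
    (hQ : (Q α n).eval (-size n - β) ≠ 0) (hQpred : (Q α n).eval (-size n - β - 1) ≠ 0)
    (hQsucc : (Q α n).eval (-size n - β + 1) ≠ 0) :
    ∑ j, aCoeff α β n j = sumFormula α β n := by
  rw [← sum_aFormula hgap hQ hQpred hQsucc]
  refine Finset.sum_congr rfl fun j _ => aCoeff_eq_aFormula hα hβ hQ fun hj => ?_
  exact eval_Q_ne_zero_iff.1 hQsucc j (by linarith)

end Formulas

/-! ### Dependence on `β` -/

theorem eventually_eval_ne_zero {T R : Type*} [TopologicalSpace T] [T1Space T] [CommRing R]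
    [IsDomain R] {p : R[X]} (hp : p ≠ 0) {f : T → R} (hf : Function.Injective f) (t : T) :
    ∀ᶠ u in 𝓝[≠] t, p.eval (f u) ≠ 0 :=
  nhdsNE_le_cofinite t
    (hf.tendsto_cofinite.eventually (finite_setOfPred_isRoot hp).compl_mem_cofinite)

section Limits

variable {r : ℕ} {α : Fin r → ℝ} {β : ℝ}

theorem Q_ne_zero (α : Fin r → ℝ) (n : Fin r → ℕ) : Q α n ≠ 0 := by
  have hQ : (Q α n).Monic := monic_prod_X_sub_C (fun j => (n j : ℝ) + α j) Finset.univ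
  exact hQ.ne_zero

theorem eventually_eval_Q_ne_zero (α : Fin r → ℝ) (β : ℝ) (n : Fin r → ℕ) :
    ∀ᶠ β' in 𝓝[≠] β, (Q α n).eval (-(size n : ℝ) - β') ≠ 0 :=
  eventually_eval_ne_zero (Q_ne_zero α n) sub_right_injective β

theorem eventually_eval_Q_pred_ne_zero (α : Fin r → ℝ) (β : ℝ) (n : Fin r → ℕ) :
    ∀ᶠ β' in 𝓝[≠] β, (Q α n).eval (-(size n : ℝ) - β' - 1) ≠ 0 :=
  eventually_eval_ne_zero (Q_ne_zero α n) (sub_left_injective.comp sub_right_injective) β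

theorem eventually_eval_Q_succ_ne_zero (α : Fin r → ℝ) (β : ℝ) (n : Fin r → ℕ) :
    ∀ᶠ β' in 𝓝[≠] β, (Q α n).eval (-(size n : ℝ) - β' + 1) ≠ 0 :=
  eventually_eval_ne_zero (Q_ne_zero α n) ((add_left_injective 1).comp sub_right_injective) β

theorem continuousAt_delta (hα : ∀ j, -1 < α j) (hβ : -1 < β) (n : Fin r → ℕ) :
    ContinuousAt (fun β' : ℝ => delta α β' n) β := by
  have hdenominator := eval_nodalPoly_neg_sub_one_ne_zero hα hβ n
  unfold delta
  fun_prop (disch := assumption)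

theorem continuousAt_aCoeff (hα : ∀ j, -1 < α j) (hβ : -1 < β) (n : Fin r → ℕ) (j : Fin r) :
    ContinuousAt (fun β' => aCoeff α β' n j) β := by
  by_cases hj : n j = 0
  · have hzero (β' : ℝ) : aCoeff α β' n j = 0 := by simp [aCoeff, hj]
    simpa only [hzero] using continuousAt_const
  have hnj : (1 : ℝ) ≤ n j := Nat.one_le_cast.2 (Nat.one_le_iff_ne_zero.2 hj)
  have hsize : (n j : ℝ) ≤ size n := Nat.cast_le.2 (le_size n j)
  have hsucc : size n + n j + α j + β + 1 ≠ 0 := by linarith [hα j]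
  have hself : size n + n j + α j + β ≠ 0 := by linarith [hα j]
  have hfactors := mul_ne_zero hsucc hself
  have hdenominator := eval_nodalPoly_neg_sub_one_ne_zero hα hβ n
  unfold aCoeff
  fun_prop (disch := assumption)

theorem tendsto_deltaFormula (hα : ∀ j, -1 < α j) (hβ : -1 < β) (n : Fin r → ℕ) :
    Tendsto (fun β' => deltaFormula α β' n) (𝓝[≠] β) (𝓝 (delta α β n)) := by
  refine (continuousAt_delta hα hβ n).continuousWithinAt.tendsto.congr' ?_
  filter_upwards [nhdsWithin_le_nhds (lt_mem_nhds hβ), eventually_eval_Q_ne_zero α β n] with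
    β' hβ' hQ
  exact delta_eq_deltaFormula hα hβ' hQ

theorem tendsto_aFormula (hα : ∀ j, -1 < α j) (hβ : -1 < β) (n : Fin r → ℕ) (j : Fin r) :
    Tendsto (fun β' => aFormula α β' n j) (𝓝[≠] β) (𝓝 (aCoeff α β n j)) := by
  refine (continuousAt_aCoeff hα hβ n j).continuousWithinAt.tendsto.congr' ?_
  filter_upwards [nhdsWithin_le_nhds (lt_mem_nhds hβ), eventually_eval_Q_ne_zero α β n,
    eventually_eval_Q_succ_ne_zero α β n] with β' hβ' hQ hQsucc
  exact aCoeff_eq_aFormula hα hβ' hQ fun hj => eval_Q_ne_zero_iff.1 hQsucc j (by linarith)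

theorem tendsto_sumFormula (hα : ∀ j, -1 < α j) (hβ : -1 < β) (hgap : NonIntegerGaps α)
    (n : Fin r → ℕ) :
    Tendsto (fun β' => sumFormula α β' n) (𝓝[≠] β) (𝓝 (∑ j, aCoeff α β n j)) := by
  refine (tendsto_finsetSum Finset.univ fun j _ => tendsto_aFormula hα hβ n j).congr' ?_
  filter_upwards [eventually_eval_Q_ne_zero α β n, eventually_eval_Q_pred_ne_zero α β n,
    eventually_eval_Q_succ_ne_zero α β n] with β' hQ hQpred hQsucc
  exact sum_aFormula hgap hQ hQpred hQsucc

end Limits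

end JacobiPineiro

end

theorem mainTheorem8 (r : ℕ) (α : Fin r → ℝ) (β : ℝ)
    (hα : ∀ j, -1 < α j) (hβ : -1 < β)
    (hαα : ∀ i j, i ≠ j → ∀ m : ℤ, α i - α j ≠ (m : ℝ)) :
    ∃ (P : (Fin r → ℕ) → ℝ[X]) (a b : (Fin r → ℕ) → Fin r → ℝ),
      -- `P n` is the unique type II polynomial of multi-index `n`
      (∀ n p, JacobiPineiro.IsTypeII α β n p ↔ p = P n) ∧
      -- `a n`, `b n` are the unique recurrence coefficients at `n`
      (∀ n a' b', JacobiPineiro.IsRecurrenceCoeff P n a' b' ↔ a' = a n ∧ b' = b n) ∧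
      -- the coefficients `a_{n,j}`; the second clause covers the parameters at which the
      -- formula reads `0 / 0`
      (∀ n j,
        ((∀ i, (JacobiPineiro.size n : ℝ) + n i + α i + β ≠ 0) →
          (JacobiPineiro.size n : ℝ) + n j + α j + β + 1 ≠ 0 →
          (JacobiPineiro.size n : ℝ) + n j + α j + β - 1 ≠ 0 →
          a n j = JacobiPineiro.aFormula α β n j) ∧
        Tendsto (fun β' => JacobiPineiro.aFormula α β' n j) (𝓝[≠] β) (𝓝 (a n j))) ∧
      -- the subleading coefficient `δ_n` of `P n`
      (∀ n,
        ((JacobiPineiro.Q α n).eval (-(JacobiPineiro.size n : ℝ) - β) ≠ 0 →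
          (P n).nextCoeff = JacobiPineiro.deltaFormula α β n) ∧
        Tendsto (fun β' => JacobiPineiro.deltaFormula α β' n) (𝓝[≠] β) (𝓝 (P n).nextCoeff)) ∧
      -- the coefficients `b_{n,k}`
      (∀ n k, b n k = (P n).nextCoeff - (P (n + Pi.single k 1)).nextCoeff) ∧
      -- the sum of the `a_{n,j}`
      (∀ n,
        ((JacobiPineiro.Q α n).eval (-(JacobiPineiro.size n : ℝ) - β) ≠ 0 →
          (JacobiPineiro.Q α n).eval (-(JacobiPineiro.size n : ℝ) - β - 1) ≠ 0 →
          (JacobiPineiro.Q α n).eval (-(JacobiPineiro.size n : ℝ) - β + 1) ≠ 0 →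
          ∑ j, a n j = JacobiPineiro.sumFormula α β n) ∧
        Tendsto (fun β' => JacobiPineiro.sumFormula α β' n) (𝓝[≠] β) (𝓝 (∑ j, a n j))) := by
  have hgap : JacobiPineiro.NonIntegerGaps α := fun i j => hαα i j
  choose P hP using JacobiPineiro.exists_isTypeII hα hβ hgap
  have hdelta (n : Fin r → ℕ) := (hP n).nextCoeff_eq_delta hα hβ hgap
  have hcoeff := JacobiPineiro.isRecurrenceCoeff_aCoeff hP hα hβ hgap
  refine ⟨P, JacobiPineiro.aCoeff α β,
    fun n k => (P n).nextCoeff - (P (n + Pi.single k 1)).nextCoeff,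
    fun n p => ⟨fun hp => hp.unique (hP n) hα hβ hgap, fun hp => hp ▸ hP n⟩,
    fun n a b => ⟨fun hab => hab.unique hP hα hβ hgap (hcoeff n), ?_⟩,
    fun n j => ⟨fun hself _ hpred => ?_, JacobiPineiro.tendsto_aFormula hα hβ n j⟩,
    fun n => ?_, fun _ _ => rfl,
    fun n => ⟨JacobiPineiro.sum_aCoeff_eq_sumFormula hα hβ hgap,
      JacobiPineiro.tendsto_sumFormula hα hβ hgap n⟩⟩
  · rintro ⟨rfl, rfl⟩
    exact hcoeff n
  · have hQ : (JacobiPineiro.Q α n).eval (-(JacobiPineiro.size n : ℝ) - β) ≠ 0 :=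
      JacobiPineiro.eval_Q_ne_zero_iff.2 fun i hi => hself i (by linarith)
    exact JacobiPineiro.aCoeff_eq_aFormula hα hβ hQ hpred
  · rw [hdelta]
    exact ⟨JacobiPineiro.delta_eq_deltaFormula hα hβ, JacobiPineiro.tendsto_deltaFormula hα hβ n⟩
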